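/- Let $q$ be a prime power, $\mathbb{F}_q$ the field with $q$ elements, $n\ge 0$ an integer, and let $C_{\mathbb{F}_q}(n)$ be the graph whose vertices are all subspaces of an $n$-dimensional vector space over $\mathbb{F}_q$, two subspaces $X,Y$ being adjacent iff $X\subseteq Y$ or $Y\subseteq X$, and $|\dim X-\dim Y|=1$. For $k\in\mathbb{N}$ put $[k]_q=1+q+\cdots+q^{k-1}$ (so $[0]_q=0$), and let ${n\brack k}_q$ be the number of $k$-dimensional subspaces of an $n$-dimensional vector space over $\mathbb{F}_q$. For integers $k,n\ge 0$ with $k\le n/2$ and for $k\le j\le n-k+1$ define polynomials $F_q(n,k,j)$ in $q$ with integer coefficients by $$F_q(n,k,n-k+1)=1,\qquad F_q(n,k,n-k)=[k]_q+[n-k]_q,$$ and, for $k\le j<n-k$, $$F_q(n,k,j)=([j]_q+[n-j]_q)\,F_q(n,k,j+1)-q^k[j+1-k]_q[n-k-j]_q\,F_q(n,k,j+2).$$ Then ${n\brack k}_q\ge{n\brack k-1}_q$ for $1\le k\le\lfloor n/2\rfloor$, and the number $c(C_{\mathbb{F}_q}(n))$ of spanning trees of $C_{\mathbb{F}_q}(n)$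 is $$c(C_{\mathbb{F}_q}(n))=[1]_q[2]_q\cdots[n]_q\ \prod_{k=1}^{\lfloor n/2\rfloor}F_q(n,k,k)^{{n\brack k}_q-{n\brack k-1}_q}.$$ Moreover, for $0\le k\le n/2$ let $N$ be the real symmetric tridiagonal matrix with rows and columns indexed by $\{k,k+1,\ldots,n-k\}$, with diagonal entries $N(j,j)=[j]_q+[n-j]_q$ and off-diagonal entries $N(j,j+1)=N(j+1,j)=-\sqrt{q^k[j+1-k]_q[n-k-j]_q}$ for $k\le j<n-k$. Then for $k\le j\le n-k+1$, $F_q(n,k,j)$ equals the determinant of the principal submatrix of $N$ with index set $\{j,j+1,\ldots,n-k\}$, which has size $n-k-j+1$ (at most $n$ unless $k=j=0$); the empty matrix has determinant $1$. -/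

import Mathlib

open Polynomial

/-- The number of spanning trees (the complexity) of a graph `G`: spanning trees are given by
their edge sets, i.e. they are the trees on the whole vertex set of `G` contained in `G`. -/
noncomputable def complexity {W : Type*} (G : SimpleGraph W) : ℕ :=
  Nat.card {T : SimpleGraph W // T ≤ G ∧ T.IsTree}

/-- The vector space analog of the hypercube: vertices are the subspaces of `V`, and `X`, `Y` are
adjacent iff one of them contains the other and their dimensions differ by exactly `1`. -/
def subspaceGraph (K V : Type*) [Field K] [AddCommGroup V] [Module K V] :
    SimpleGraph (Submodule K V) where
  Adj X Y := (X ≤ Y ∨ Y ≤ X) ∧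
    |(Module.finrank K X : ℤ) - (Module.finrank K Y : ℤ)| = 1
  symm := ⟨fun _ _ h => ⟨h.1.symm, by rw [abs_sub_comm]; exact h.2⟩⟩
  loopless := ⟨fun _ h => by simp at h⟩

/-- The Gaussian coefficient: the number of `k`-dimensional subspaces of `V`. -/
noncomputable def gaussCoeff (K V : Type*) [Field K] [AddCommGroup V] [Module K V] (k : ℕ) : ℕ :=
  Nat.card {X : Submodule K V // Module.finrank K X = k}

/-- The `q`-number `1 + q + ⋯ + q ^ (k - 1)`. -/
def qNumber {R : Type*} [Semiring R] (q : R) (k : ℕ) : R :=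
  ∑ i ∈ Finset.range k, q ^ i

/-- The polynomials `F(n, k, j)` in the indeterminate `q = X`, with integer coefficients, given by a
three-term downward recursion on `j`. They are meaningful for `2 * k ≤ n` and
`k ≤ j ≤ n - k + 1`. -/
noncomputable def fPoly (n k j : ℕ) : ℤ[X] :=
  if n < k + j then 1
  else if n = k + j then qNumber X k + qNumber X (n - k)
  else (qNumber X j + qNumber X (n - j)) * fPoly n k (j + 1) -
    (X ^ k * qNumber X (j + 1 - k) * qNumber X (n - k - j)) * fPoly n k (j + 2)
termination_by n - j

theorem fPoly_top {n k : ℕ} (h : 2 * k ≤ n) : fPoly n k (n - k + 1) = 1 := by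
  rw [fPoly, if_pos (by omega)]

theorem fPoly_base {n k : ℕ} (h : 2 * k ≤ n) :
    fPoly n k (n - k) = qNumber X k + qNumber X (n - k) := by
  rw [fPoly, if_neg (by omega), if_pos (by omega)]

theorem fPoly_rec {n k j : ℕ} (h : j < n - k) :
    fPoly n k j = (qNumber X j + qNumber X (n - j)) * fPoly n k (j + 1) -
      (X ^ k * qNumber X (j + 1 - k) * qNumber X (n - k - j)) * fPoly n k (j + 2) := by
  rw [fPoly, if_neg (by omega), if_neg (by omega)]

/-- The real symmetric tridiagonal matrix `N(k, n - k, n)` with rows and columns indexed by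
`{k, k + 1, …, n - k}`. -/
noncomputable def blockMatrix (q n k : ℕ) :
    Matrix (Finset.Icc k (n - k)) (Finset.Icc k (n - k)) ℝ :=
  Matrix.of fun i j =>
    if i.1 + 1 = j.1 then
      -√((q : ℝ) ^ k * qNumber (q : ℝ) (j.1 - k) * qNumber (q : ℝ) (n - k - j.1 + 1))
    else if i.1 = j.1 then
      qNumber (q : ℝ) j.1 + qNumber (q : ℝ) (n - j.1)
    else if i.1 = j.1 + 1 then
      -√((q : ℝ) ^ k * qNumber (q : ℝ) (j.1 + 1 - k) * qNumber (q : ℝ) (n - k - j.1))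
    else 0

/-- The index set `{j, j + 1, …, n - k}`, as a subset of `{k, k + 1, …, n - k}`. -/
abbrev TailIndex (n k j : ℕ) : Type := {i : Finset.Icc k (n - k) // j ≤ i.1}

/-- The principal submatrix `N_j(k, n - k, n)` of `N(k, n - k, n)` on the rows and columns
`{j, j + 1, …, n - k}`. -/
noncomputable def tailBlock (q n k j : ℕ) : Matrix (TailIndex n k j) (TailIndex n k j) ℝ :=
  (blockMatrix q n k).submatrix Subtype.val Subtype.val

/-! By the matrix-tree theorem the complexity is the determinant of the Laplacian with the row of
the zero subspace replaced by a unit vector. Let `U` be the 0-1 matrix of "contains as a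
hyperplane", `D` its transpose, and `b j = [j][n + 1 - j]`. Two distinct subspaces have a common
upper cover iff they have a common lower cover, each unique, so `D * U - U * D` is diagonal. Hence
in degree `j` both `b j - U * D` and `b (j + 1) - D * U` equal one operator `T`, which commutes with
`U` and `D` (`isLadder_raiseMatrix`).

The Laplacian is block tridiagonal by dimension. Its elimination only produces polynomials `Q_j(T)`,
with `Q_j` = `schurPoly`, and the determinant becomes `Q_1(T)` on degree 0 times the ratios of `det
Q_{j+1}(T)` on degree `j + 1` to that on degree `j` (`det_tridiagonal`). Since `U * D` and `D * U`
share their nonzero spectrum, each ratio is `Q_{j+1}(b (j+1))` to the power of the difference of the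
two Gaussian coefficients (`det_aeval_toSquareBlock_succ`).

Finally `Q_1(0) = [1]⋯[n]`. The symmetry `b k = b (n + 1 - k)` pairs the factors `k` and `n + 1 -
k`, whose exponents are opposite, and `Q_k(b k) / Q_{n+1-k}(b k)` is `F(n, k, k)`
(`eval_schurPoly_qWeight`). The determinant form of `F` is the three-term recurrence for tridiagonal
determinants. -/

/-- A matrix which is unitriangular with respect to a grading of its indices has determinant `1`. -/
theorem Matrix.det_eq_one_of_graded {R W : Type*} [CommRing R] [Fintype W] [DecidableEq W]
    {M : Matrix W W R} (d : W → ℕ) (hone : ∀ v, M v v = 1)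
    (hz : ∀ v w, v ≠ w → d v ≤ d w → M v w = 0) : M.det = 1 := by
  have hbt : M.BlockTriangular (OrderDual.toDual ∘ d) := by
    intro v w hvw
    have h' : d v < d w := hvw
    exact hz v w (by rintro rfl; omega) h'.le
  rw [hbt.det]
  refine Finset.prod_eq_one fun a _ => ?_
  have : M.toSquareBlock (OrderDual.toDual ∘ d) a = 1 := by
    ext ⟨v, hv⟩ ⟨w, hw⟩
    by_cases hvw : v = w
    · subst hvw
      rw [Matrix.one_apply_eq]
      exact hone v
    · have : d v = d w := by
        have := hv.trans hw.symm
        simpa using this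
      rw [Matrix.one_apply_ne (by simpa using hvw)]
      exact hz v w hvw this.le
  rw [this, Matrix.det_one]

/-! ### Rooted trees as parent functions -/

section ParentGraph

variable {W : Type*}

/-- The graph with edges `{v, f v}`. -/
def parentGraph (f : W → W) : SimpleGraph W := SimpleGraph.fromRel fun v w => f v = w

theorem parentGraph_adj {f : W → W} {v w : W} :
    (parentGraph f).Adj v w ↔ v ≠ w ∧ (f v = w ∨ f w = v) := Iff.rfl

theorem parentGraph_connected {r : W} {f : W → W} (h : ∀ v, ∃ k, f^[k] v = r) :
    (parentGraph f).Connected := by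
  have hr : ∀ k v, f^[k] v = r → (parentGraph f).Reachable v r := by
    intro k
    induction k with
    | zero => rintro v rfl; exact SimpleGraph.Reachable.refl _
    | succ k ih =>
      intro v hv
      by_cases hfv : v = f v
      · refine ih v ?_
        rw [Function.iterate_succ_apply, ← hfv] at hv
        exact hv
      · have hadj : (parentGraph f).Adj v (f v) := parentGraph_adj.2 ⟨hfv, Or.inl rfl⟩
        exact hadj.reachable.trans (ih (f v) hv)
  have hr' : ∀ v, (parentGraph f).Reachable v r := fun v => (h v).elim fun k hk => hr k v hk
  have : Nonempty W := ⟨r⟩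
  exact ⟨fun v w => (hr' v).trans (hr' w).symm⟩

/-- If `f v ≠ g v`, the edge `{v, f v}` must come from `g (f v) = v`, and then `f` and `g` also
differ at `f v`. The disagreement thus travels along the `f`-orbit up to `r`, where both maps fix
`r`. -/
theorem parentGraph_injOn {r : W} {f g : W → W} (hfr : f r = r) (hgr : g r = r)
    (hne : ∀ v ≠ r, v ≠ f v) (hf : ∀ v, ∃ k, f^[k] v = r)
    (hfg : parentGraph f = parentGraph g) : f = g := by
  by_contra hcon
  obtain ⟨v, hv⟩ := Function.ne_iff.1 hcon
  have step : ∀ v, f v ≠ g v → f (f v) ≠ g (f v) := by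
    intro v hv heq
    have hvr : v ≠ r := by
      rintro rfl
      exact hv (hfr.trans hgr.symm)
    have hadj : (parentGraph g).Adj v (f v) := by
      rw [← hfg]
      exact parentGraph_adj.2 ⟨hne v hvr, Or.inl rfl⟩
    have h1 : g (f v) = v := by
      rcases (parentGraph_adj.1 hadj).2 with h | h
      · exact absurd h.symm hv
      · exact h
    have h2 : f (f v) = v := heq.trans h1
    have h3 : f v ≠ r := by
      intro h
      rw [h, hgr] at h1
      exact hvr h1.symm
    obtain ⟨k, hk⟩ := hf v
    -- A 2-cycle `v, f v` avoiding `r` would keep the orbit of `v` from ever reaching `r`.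
    have h4 : ∀ k, f^[k] v = v ∨ f^[k] v = f v := by
      intro k
      induction k with
      | zero => exact Or.inl rfl
      | succ k ih =>
        rw [Function.iterate_succ_apply']
        rcases ih with ih | ih
        · exact Or.inr (by rw [ih])
        · exact Or.inl (by rw [ih, h2])
    rcases h4 k with h | h
    · exact hvr (h.symm.trans hk)
    · exact h3 (h.symm.trans hk)
  obtain ⟨k, hk⟩ := hf v
  have : ∀ k, f (f^[k] v) ≠ g (f^[k] v) := by
    intro k
    induction k with
    | zero => exact hv
    | succ k ih =>
      rw [Function.iterate_succ_apply']
      exact step _ ih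
  apply this k
  rw [hk, hfr, hgr]

/-- Send each vertex to a neighbour closer to `r`. The resulting graph is connected and contained in
`T`, and a tree is minimal among connected graphs. -/
theorem exists_parentGraph_eq {T : SimpleGraph W} (hT : T.IsTree) (r : W) :
    ∃ f : W → W, f r = r ∧ (∀ v ≠ r, T.Adj v (f v)) ∧ (∀ v, ∃ k, f^[k] v = r) ∧
      parentGraph f = T := by
  classical
  have hstep : ∀ v, ∃ w, v ≠ r → T.Adj v w ∧ T.dist w r < T.dist v r := by
    intro v
    by_cases hv : v = r
    · exact ⟨v, fun h => absurd hv h⟩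
    · obtain ⟨p, hp⟩ := hT.connected.exists_walk_length_eq_dist v r
      cases p with
      | nil => exact absurd rfl hv
      | cons hadj p =>
        refine ⟨_, fun _ => ⟨hadj, ?_⟩⟩
        have := SimpleGraph.dist_le p
        rw [SimpleGraph.Walk.length_cons] at hp
        omega
  choose g hg using hstep
  let f : W → W := fun v => if v = r then r else g v
  have hfr : f r = r := if_pos rfl
  have hfv : ∀ v, v ≠ r → f v = g v := fun v hv => if_neg hv
  have hadj : ∀ v ≠ r, T.Adj v (f v) := fun v hv => by
    rw [hfv v hv]; exact (hg v hv).1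
  have hreach : ∀ m v, T.dist v r ≤ m → ∃ k, f^[k] v = r := by
    intro m
    induction m with
    | zero =>
      intro v hv
      refine ⟨0, ?_⟩
      by_contra hne
      exact absurd (hg v hne).2 (by omega)
    | succ m ih =>
      intro v hv
      by_cases hvr : v = r
      · exact ⟨0, hvr⟩
      · have := (hg v hvr).2
        obtain ⟨k, hk⟩ := ih (f v) (by rw [hfv v hvr]; omega)
        exact ⟨k + 1, hk⟩
  have hreach' : ∀ v, ∃ k, f^[k] v = r := fun v => hreach _ v le_rfl
  refine ⟨f, hfr, hadj, hreach', ?_⟩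
  have hle : parentGraph f ≤ T := by
    have key : ∀ v w, v ≠ w → f v = w → T.Adj v w := by
      rintro v w hvw rfl
      refine hadj v ?_
      rintro rfl
      exact hvw hfr.symm
    intro v w h
    obtain ⟨hvw, h1 | h1⟩ := parentGraph_adj.1 h
    · exact key v w hvw h1
    · exact (key w v hvw.symm h1).symm
  exact le_antisymm hle
    ((SimpleGraph.isTree_iff_minimal_connected.1 hT).2 (parentGraph_connected hreach') hle)

end ParentGraph

/-! ### The matrix-tree theorem -/

section MatrixTree

variable {W : Type*} [Fintype W] [DecidableEq W]

/-- The Laplacian of `G` over `ℚ`, with the row of the root `r` replaced by a unit vector. -/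
def rootedLaplacian (G : SimpleGraph W) [DecidableRel G.Adj] (r : W) : Matrix W W ℚ :=
  Matrix.of fun v w => if v = r then (if w = r then 1 else 0) else
    (if v = w then (G.degree v : ℚ) else 0) - (if G.Adj v w then 1 else 0)

/-- The matrix whose row at `v ≠ r` is `e_v - e_{f v}` and whose row at `r` is `e_r`. -/
def parentMatrix (r : W) (f : W → W) : Matrix W W ℚ :=
  Matrix.of fun v => if v = r then Pi.single r 1 else Pi.single v 1 - Pi.single (f v) 1

/-- Graded by the number of steps to `r`, the matrix is unitriangular. -/
theorem det_parentMatrix_of_forall_exists {r : W} {f : W → W}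
    (h : ∀ v, ∃ k, f^[k] v = r) : (parentMatrix r f).det = 1 := by
  classical
  let d : W → ℕ := fun v => Nat.find (h v)
  have hd : ∀ v, v ≠ r → d (f v) < d v := by
    intro v hv
    have h1 : f^[d v] v = r := Nat.find_spec (h v)
    obtain ⟨m, hm⟩ : ∃ m, d v = m + 1 := by
      refine Nat.exists_eq_succ_of_ne_zero fun h0 => hv ?_
      rw [h0] at h1
      exact h1
    have h2 : f^[m] (f v) = r := by rw [hm] at h1; exact h1
    have h3 : d (f v) ≤ m := Nat.find_min' (h (f v)) h2
    omega
  have hz : ∀ v w, v ≠ w → d v ≤ d w → parentMatrix r f v w = 0 := by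
    intro v w hvw hdw
    by_cases hv : v = r
    · subst hv
      simp [parentMatrix, hvw.symm]
    · have : w ≠ f v := by
        rintro rfl
        exact absurd (hd v hv) (by omega)
      simp [parentMatrix, hv, hvw.symm, this]
  have hone : ∀ v, parentMatrix r f v v = 1 := by
    intro v
    by_cases hv : v = r
    · simp [parentMatrix, hv]
    · have : v ≠ f v := by
        intro h'
        have := hd v hv
        rw [← h'] at this
        omega
      simp [parentMatrix, hv, this]
  exact Matrix.det_eq_one_of_graded d hone hz

/-- The indicator of the vertices that never reach `r` is a nonzero kernel vector. -/
theorem det_parentMatrix_of_not_forall_exists {r : W} {f : W → W} (hr : f r = r)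
    (h : ¬ ∀ v, ∃ k, f^[k] v = r) : (parentMatrix r f).det = 0 := by
  classical
  push Not at h
  obtain ⟨v₀, hv₀⟩ := h
  let x : W → ℚ := fun v => if ∀ k, f^[k] v ≠ r then 1 else 0
  have hx : ∀ v, v ≠ r → x (f v) = x v := by
    intro v hv
    have : (∀ k, f^[k] (f v) ≠ r) ↔ ∀ k, f^[k] v ≠ r := by
      refine ⟨fun h k => ?_, fun h k => h (k + 1)⟩
      cases k with
      | zero => exact hv
      | succ k => exact h k
    simp only [x, this]
  refine Matrix.exists_mulVec_eq_zero_iff.1 ⟨x, fun h0 => ?_, ?_⟩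
  · have := congrFun h0 v₀
    simp [x, hv₀] at this
  · ext v
    by_cases hv : v = r
    · subst hv
      have : x v = 0 := if_neg fun h => h 0 rfl
      simp [parentMatrix, Matrix.mulVec, this]
    · have : parentMatrix r f v = Pi.single v 1 - Pi.single (f v) 1 := by
        ext w
        simp [parentMatrix, hv]
      rw [Matrix.mulVec, this, sub_dotProduct]
      simp [hx v hv]

/-- The row at `v ≠ r` is the sum of `e_v - e_w` over the neighbours `w`. Multilinearity expands the
determinant over all choices `f` of one neighbour per vertex, and each choice contributes 1 or 0. -/
theorem det_rootedLaplacian_eq_card (G : SimpleGraph W) [DecidableRel G.Adj] (r : W) :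
    (rootedLaplacian G r).det =
      Nat.card {f : W → W // (f r = r ∧ ∀ v ≠ r, G.Adj v (f v)) ∧ ∀ v, ∃ k, f^[k] v = r} := by
  classical
  let N : W → Finset W := fun v => if v = r then {r} else G.neighborFinset v
  have hN : ∀ f : W → W, f ∈ Fintype.piFinset N ↔ (f r = r ∧ ∀ v ≠ r, G.Adj v (f v)) := by
    intro f
    rw [Fintype.mem_piFinset]
    refine ⟨fun h => ⟨by simpa [N] using h r, fun v hv => by simpa [N, hv] using h v⟩, ?_⟩
    rintro ⟨h1, h2⟩ v
    by_cases hv : v = r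
    · subst hv
      simp [N, h1]
    · simpa [N, hv] using h2 v hv
  have hM : rootedLaplacian G r = fun v => ∑ w ∈ N v,
      (if v = r then Pi.single r (1 : ℚ) else Pi.single v 1 - Pi.single w 1 : W → ℚ) := by
    ext v w
    by_cases hv : v = r
    · simp [rootedLaplacian, N, hv, Pi.single_apply]
    · simp only [rootedLaplacian, N, hv, Matrix.of_apply, if_false, Finset.sum_apply,
        Finset.sum_sub_distrib, Pi.sub_apply, Pi.single_apply, Finset.sum_const, G.card_neighborFinset_eq_degree]
      simp [eq_comm]
  have hdet : (rootedLaplacian G r).det =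
      ∑ f ∈ Fintype.piFinset N, (parentMatrix r f).det := by
    rw [hM]
    exact (Matrix.detRowAlternating (R := ℚ) (n := W)).toMultilinearMap.map_sum_finset
      (fun v w => (if v = r then Pi.single r (1 : ℚ) else Pi.single v 1 - Pi.single w 1 : W → ℚ)) N
  have hsum : ∀ f ∈ Fintype.piFinset N, (parentMatrix r f).det =
      if ∀ v, ∃ k, f^[k] v = r then 1 else 0 := by
    intro f hf
    split_ifs with h
    · exact det_parentMatrix_of_forall_exists h
    · exact det_parentMatrix_of_not_forall_exists ((hN f).1 hf).1 h
  rw [hdet, Finset.sum_congr rfl hsum, Finset.sum_boole, Nat.card_eq_fintype_card,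
    Fintype.card_subtype]
  congr 2
  ext f
  simp only [Finset.mem_filter, hN, Finset.mem_univ, true_and]

/-- It is connected, and `v ↦ {v, f v}` maps the non-root vertices onto the edges, so there are at
most `|W| - 1` edges. -/
theorem parentGraph_isTree {r : W} {f : W → W} (hr : f r = r) (hne : ∀ v ≠ r, v ≠ f v)
    (h : ∀ v, ∃ k, f^[k] v = r) : (parentGraph f).IsTree := by
  have hc := parentGraph_connected h
  refine SimpleGraph.isTree_iff_connected_and_card.2 ⟨hc, le_antisymm ?_
    hc.card_vert_le_card_edgeSet_add_one⟩
  let φ : {v // v ≠ r} → (parentGraph f).edgeSet := fun v =>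
    ⟨s(v.1, f v.1), parentGraph_adj.2 ⟨hne v v.2, Or.inl rfl⟩⟩
  have hφ : Function.Surjective φ := by
    have key : ∀ v w, v ≠ w → f v = w → v ≠ r := by
      rintro v w hvw hw rfl
      exact hvw (hr.symm.trans hw)
    rintro ⟨e, he⟩
    induction e with
    | h v w =>
      obtain ⟨hvw, h1 | h1⟩ := parentGraph_adj.1 he
      · exact ⟨⟨v, key v w hvw h1⟩, Subtype.ext (by simp [φ, h1])⟩
      · exact ⟨⟨w, key w v hvw.symm h1⟩, Subtype.ext (by simp [φ, h1, Sym2.eq_swap])⟩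
  have h1 := Nat.card_le_card_of_surjective φ hφ
  have h2 : Nat.card {v // v ≠ r} = Fintype.card W - 1 := by
    rw [Nat.card_eq_fintype_card]
    simp
  have h3 : 0 < Fintype.card W := Fintype.card_pos_iff.2 ⟨r⟩
  rw [Nat.card_eq_fintype_card (α := W)]
  omega

/-- The **matrix-tree theorem**. -/
theorem complexity_eq_det_rootedLaplacian (G : SimpleGraph W) [DecidableRel G.Adj] (r : W) :
    (complexity G : ℚ) = (rootedLaplacian G r).det := by
  rw [det_rootedLaplacian_eq_card, complexity]
  congr 1
  symm
  have hle : ∀ f : W → W, f r = r → (∀ v ≠ r, G.Adj v (f v)) → parentGraph f ≤ G := by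
    intro f hfr hadj
    have key : ∀ v w, v ≠ w → f v = w → G.Adj v w := by
      rintro v w hvw rfl
      refine hadj v ?_
      rintro rfl
      exact hvw hfr.symm
    intro v w h
    obtain ⟨hvw, h1 | h1⟩ := parentGraph_adj.1 h
    · exact key v w hvw h1
    · exact (key w v hvw.symm h1).symm
  refine Nat.card_congr (Equiv.ofBijective (fun f => ⟨parentGraph f.1,
    hle f.1 f.2.1.1 f.2.1.2, parentGraph_isTree f.2.1.1 (fun v hv => (f.2.1.2 v hv).ne) f.2.2⟩)
    ⟨?_, ?_⟩)
  · intro f g hfg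
    exact Subtype.ext (parentGraph_injOn f.2.1.1 g.2.1.1 (fun v hv => (f.2.1.2 v hv).ne) f.2.2
      (congrArg Subtype.val hfg))
  · rintro ⟨T, hTG, hT⟩
    obtain ⟨f, hfr, hadj, hreach, rfl⟩ := exists_parentGraph_eq hT r
    exact ⟨⟨f, ⟨hfr, fun v hv => hTG (hadj v hv)⟩, hreach⟩, rfl⟩

end MatrixTree

/-! ### q-numbers and the two polynomial recursions -/

section QNumber

variable {R : Type*} [CommRing R] (q : R)

@[simp] theorem qNumber_zero : qNumber q 0 = 0 := by simp [qNumber]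

@[simp] theorem qNumber_one : qNumber q 1 = 1 := by simp [qNumber]

theorem qNumber_add (a b : ℕ) : qNumber q (a + b) = qNumber q a + q ^ a * qNumber q b := by
  simp only [qNumber, Finset.sum_range_add, Finset.mul_sum, pow_add]

theorem pow_eq_one_add_qNumber (a : ℕ) : q ^ a = 1 + (q - 1) * qNumber q a := by
  rw [qNumber, mul_geom_sum]
  ring

/-- The product `[j] [n + 1 - j]`. -/
def qWeight (n j : ℕ) : R := qNumber q j * qNumber q (n + 1 - j)

/-- This turns the recursion of `schurPoly`, evaluated at `qWeight q n k`, into that of `fPoly`.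
After expansion, both sides agree because `(q ^ a - 1)[k] = (q ^ k - 1)[a]`. -/
theorem qWeight_succ_sub_qWeight {n k j : ℕ} (hkj : k ≤ j) (hj : k + j ≤ n) :
    qWeight q n (j + 1) - qWeight q n k =
      q ^ k * qNumber q (j + 1 - k) * qNumber q (n - k - j) := by
  obtain ⟨a, rfl⟩ := Nat.exists_eq_add_of_le hkj
  obtain ⟨c, rfl⟩ := Nat.exists_eq_add_of_le hj
  have e1 : k + a + 1 = k + (a + 1) := by ring
  have e2 : k + (k + a) + c + 1 - (k + a + 1) = k + c := by omega
  have e3 : k + (k + a) + c + 1 - k = k + (a + 1 + c) := by omega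
  have e4 : k + a + 1 - k = a + 1 := by omega
  have e5 : k + (k + a) + c - k - (k + a) = c := by omega
  rw [qWeight, qWeight, e2, e3, e4, e5, e1, qNumber_add q k (a + 1), qNumber_add q k c, qNumber_add q k (a + 1 + c),
    qNumber_add q (a + 1) c]
  linear_combination (-(q ^ k * qNumber q k * qNumber q c)) * pow_eq_one_add_qNumber q (a + 1) +
    q ^ k * qNumber q (a + 1) * qNumber q c * pow_eq_one_add_qNumber q k

/-- The increments of the weight are the number of upper covers minus the number of lower covers, as
`IsLadder` requires. -/
theorem qWeight_succ_sub_self {n j : ℕ} (hj : j ≤ n) :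
    qWeight q n (j + 1) - qWeight q n j = qNumber q (n - j) - qNumber q j := by
  obtain ⟨c, rfl⟩ := Nat.exists_eq_add_of_le hj
  have e1 : j + c + 1 - (j + 1) = c := by omega
  have e2 : j + c + 1 - j = c + 1 := by omega
  have e3 : j + c - j = c := by omega
  rw [qWeight, qWeight, e1, e2, e3, qNumber_add, qNumber_add, qNumber_one]
  linear_combination (qNumber q c) * pow_eq_one_add_qNumber q j -
    (qNumber q j) * pow_eq_one_add_qNumber q c

theorem qWeight_zero (n : ℕ) : qWeight q n 0 = 0 := by simp [qWeight]

theorem qWeight_reflect {n j : ℕ} (hj : j ≤ n + 1) : qWeight q n (n + 1 - j) = qWeight q n j := by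
  have : n + 1 - (n + 1 - j) = j := by omega
  rw [qWeight, qWeight, this, mul_comm]

theorem aeval_fPoly_top {n k : ℕ} (h : 2 * k ≤ n) : aeval q (fPoly n k (n - k + 1)) = 1 := by
  rw [fPoly_top h, map_one]

theorem aeval_qNumber_X (k : ℕ) : aeval q (qNumber (X : ℤ[X]) k) = qNumber q k := by
  simp [qNumber]

theorem aeval_fPoly_base {n k : ℕ} (h : 2 * k ≤ n) :
    aeval q (fPoly n k (n - k)) = qNumber q k + qNumber q (n - k) := by
  rw [fPoly_base h, map_add, aeval_qNumber_X, aeval_qNumber_X]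

theorem aeval_fPoly_rec {n k j : ℕ} (h : j < n - k) :
    aeval q (fPoly n k j) = (qNumber q j + qNumber q (n - j)) * aeval q (fPoly n k (j + 1)) -
      (q ^ k * qNumber q (j + 1 - k) * qNumber q (n - k - j)) * aeval q (fPoly n k (j + 2)) := by
  rw [fPoly_rec h]
  simp only [map_sub, map_mul, map_add, map_pow, aeval_qNumber_X, aeval_X]

theorem aeval_natCast_eq_cast_eval (p : ℤ[X]) (m : ℕ) :
    aeval (m : R) p = ((p.eval (m : ℤ) : ℤ) : R) := by
  have := Polynomial.aeval_algebraMap_apply R (m : ℤ) p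
  simpa using this

/-- Polynomials `Q_j` with `Q_{n + 1} = 1`, `Q_{n + 2} = 0` and
`Q_j = ([j] + [n - j]) Q_{j + 1} - ([j + 1] [n - j] - X) Q_{j + 2}`. They describe the Schur
complements of the Laplacian of the subspace graph. -/
noncomputable def schurPoly (n j : ℕ) : R[X] :=
  if n < j then (if j = n + 1 then 1 else 0)
  else C (qNumber q j + qNumber q (n - j)) * schurPoly n (j + 1) -
    (C (qWeight q n (j + 1)) - X) * schurPoly n (j + 2)
termination_by n + 1 - j

theorem schurPoly_succ_self (n : ℕ) : schurPoly q n (n + 1) = 1 := by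
  rw [schurPoly, if_pos (by omega), if_pos rfl]

theorem schurPoly_add_two (n : ℕ) : schurPoly q n (n + 2) = 0 := by
  rw [schurPoly, if_pos (by omega), if_neg (by omega)]

theorem schurPoly_rec {n j : ℕ} (h : j ≤ n) : schurPoly q n j =
    C (qNumber q j + qNumber q (n - j)) * schurPoly q n (j + 1) -
      (C (qWeight q n (j + 1)) - X) * schurPoly q n (j + 2) := by
  rw [schurPoly, if_neg (by omega)]

theorem eval_schurPoly_rec {n j : ℕ} (h : j ≤ n) (t : R) : (schurPoly q n j).eval t =
    (qNumber q j + qNumber q (n - j)) * (schurPoly q n (j + 1)).eval t -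
      (qWeight q n (j + 1) - t) * (schurPoly q n (j + 2)).eval t := by
  rw [schurPoly_rec q h]
  simp

theorem eval_zero_schurPoly {n j : ℕ} (h : j ≤ n + 1) :
    (schurPoly q n j).eval 0 = ∏ i ∈ Finset.Icc j n, qNumber q i := by
  induction h using Nat.decreasingInduction with
  | self => simp [schurPoly_succ_self]
  | of_succ j hj ih =>
    have hj' : j ≤ n := by omega
    -- At 0 the recursion collapses to `Q_j = [j] Q_{j+1}`: the term `[n - j] Q_{j+1}` cancels `[j +
    -- 1][n - j] Q_{j+2}`.
    have key : (schurPoly q n j).eval 0 = qNumber q j * (schurPoly q n (j + 1)).eval 0 := by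
      clear ih hj
      induction hj' using Nat.decreasingInduction with
      | self =>
        rw [eval_schurPoly_rec q le_rfl, schurPoly_add_two]
        simp
      | of_succ j hj ih =>
        rw [eval_schurPoly_rec q hj.le, ih]
        have : n + 1 - (j + 1) = n - j := by omega
        rw [qWeight, this]
        ring
    rw [key, ih, ← Finset.prod_Ioc_mul_eq_prod_Icc hj', mul_comm]
    congr 1
    exact Finset.prod_congr (by ext; simp) fun _ _ => rfl

/-- Both sides satisfy the same recursion in `j`. It becomes a two-term one at `j = n - k`, where
the coefficient `b (n - k + 1) - b k` vanishes by symmetry; this is why `fPoly` starts there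
independently of `Q_{n-k+2}`. -/
theorem eval_schurPoly_qWeight {n k : ℕ} (hk : 2 * k ≤ n) {j : ℕ} (hkj : k ≤ j)
    (hj : j ≤ n - k + 1) : (schurPoly q n j).eval (qWeight q n k) =
      aeval q (fPoly n k j) * (schurPoly q n (n + 1 - k)).eval (qWeight q n k) := by
  have e : n + 1 - k = n - k + 1 := by omega
  rw [e]
  have main : ∀ m j, k ≤ j → n - k + 1 = j + m →
      (schurPoly q n j).eval (qWeight q n k) =
        aeval q (fPoly n k j) * (schurPoly q n (n - k + 1)).eval (qWeight q n k) := by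
    intro m
    induction m using Nat.twoStepInduction with
    | zero =>
      intro j _ hj
      obtain rfl : j = n - k + 1 := hj.symm
      rw [aeval_fPoly_top q hk, one_mul]
    | one =>
      intro j _ hj
      obtain rfl : j = n - k := by omega
      have e2 : n - (n - k) = k := by omega
      have e3 : qWeight q n (n - k + 1) = qWeight q n k := by
        rw [← e, qWeight_reflect q (by omega)]
      rw [aeval_fPoly_base q hk, eval_schurPoly_rec q (by omega), e2, e3]
      ring
    | more m ih0 ih1 =>
      intro j hkj hj
      rw [eval_schurPoly_rec q (by omega), ih1 (j + 1) (by omega) (by omega),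
        ih0 (j + 2) (by omega) (by omega), qWeight_succ_sub_qWeight q hkj (by omega),
        aeval_fPoly_rec q (by omega : j < n - k)]
      ring
  exact main (n - k + 1 - j) j hkj (by omega)

end QNumber

/-! ### Positivity of the Schur polynomials -/

section Positivity

variable {R : Type*} [CommRing R] [LinearOrder R] [IsStrictOrderedRing R] {q : R}

theorem qNumber_nonneg (hq : 0 ≤ q) (k : ℕ) : 0 ≤ qNumber q k :=
  Finset.sum_nonneg fun _ _ => pow_nonneg hq _

theorem qNumber_pos (hq : 0 ≤ q) {k : ℕ} (hk : 0 < k) : 0 < qNumber q k := by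
  obtain ⟨k, rfl⟩ := Nat.exists_eq_add_of_lt hk
  rw [zero_add, add_comm, qNumber_add, qNumber_one]
  have := mul_nonneg (pow_nonneg hq 1) (qNumber_nonneg hq k)
  linarith

theorem qWeight_nonneg (hq : 0 ≤ q) (n j : ℕ) : 0 ≤ qWeight q n j :=
  mul_nonneg (qNumber_nonneg hq _) (qNumber_nonneg hq _)

/-- Needed to divide by these values. The induction carries `[j] Q_{j+1} ≤ Q_j`, which propagates
through `Q_j - [j] Q_{j+1} = [n - j](Q_{j+1} - [j + 1] Q_{j+2}) + t Q_{j+2}`. -/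
theorem eval_schurPoly_pos (hq : 0 ≤ q) {n j : ℕ} (hj : 1 ≤ j) (hjn : j ≤ n + 1) {t : R}
    (ht : 0 ≤ t) : 0 < (schurPoly q n j).eval t := by
  suffices h : 0 ≤ (schurPoly q n (j + 1)).eval t ∧ 0 < (schurPoly q n j).eval t ∧
      qNumber q j * (schurPoly q n (j + 1)).eval t ≤ (schurPoly q n j).eval t from h.2.1
  revert hj
  induction hjn using Nat.decreasingInduction with
  | self =>
    intro _
    simp [schurPoly_succ_self, schurPoly_add_two]
  | of_succ j hjn ih =>
    intro hj
    obtain ⟨h0, h1, h2⟩ := ih (by omega)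
    have hle : qNumber q j * (schurPoly q n (j + 1)).eval t ≤ (schurPoly q n j).eval t := by
      have e : n + 1 - (j + 1) = n - j := by omega
      rw [eval_schurPoly_rec q (j := j) (by omega), qWeight, e]
      have h3 := mul_le_mul_of_nonneg_left h2 (qNumber_nonneg hq (n - j))
      have h4 := mul_nonneg ht h0
      have e2 : j + 1 + 1 = j + 2 := rfl
      rw [e2] at h3 h4
      nlinarith
    exact ⟨h1.le, (mul_pos (qNumber_pos hq hj) h1).trans_le hle, hle⟩

end Positivity

/-! ### Covers of subspaces and Gaussian coefficients -/

section Subspaces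

open Module

variable {K V : Type*} [Field K] [AddCommGroup V] [Module K V]

/-- `Y` contains `X` with codimension one. -/
def IsHyperplaneOf (X Y : Submodule K V) : Prop := X ≤ Y ∧ finrank K Y = finrank K X + 1

variable [FiniteDimensional K V]

theorem subspaceGraph_adj_iff {X Y : Submodule K V} :
    (subspaceGraph K V).Adj X Y ↔ IsHyperplaneOf X Y ∨ IsHyperplaneOf Y X := by
  change ((X ≤ Y ∨ Y ≤ X) ∧ |(finrank K X : ℤ) - (finrank K Y : ℤ)| = 1) ↔ _
  rw [abs_eq zero_le_one]
  constructor
  · rintro ⟨h | h, habs⟩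
    · have := Submodule.finrank_mono h
      exact Or.inl ⟨h, by omega⟩
    · have := Submodule.finrank_mono h
      exact Or.inr ⟨h, by omega⟩
  · rintro (⟨h, h'⟩ | ⟨h, h'⟩)
    · exact ⟨Or.inl h, by omega⟩
    · exact ⟨Or.inr h, by omega⟩

theorem finite_submodule [Finite K] : Finite (Submodule K V) := by
  have : Finite V := Module.finite_of_finite K
  exact Finite.of_injective _ (SetLike.coe_injective (A := Submodule K V))

theorem finrank_map_mkQ_add_finrank {X Y : Submodule K V} (h : X ≤ Y) :
    finrank K (Y.map X.mkQ) + finrank K X = finrank K Y := by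
  have h1 := (Submodule.quotientQuotientEquivQuotient X Y h).finrank_eq
  have h2 := Submodule.finrank_quotient_add_finrank (Y.map X.mkQ)
  have h3 := Submodule.finrank_quotient_add_finrank X
  have h4 := Submodule.finrank_quotient_add_finrank Y
  omega

/-- Upper covers of `X` are the lines of `V ⧸ X`, that is, the points of its projective space. -/
theorem card_isHyperplaneOf_right [Finite K] (X : Submodule K V) :
    Nat.card {Y // IsHyperplaneOf X Y} = qNumber (Nat.card K) (finrank K V - finrank K X) := by
  have h1 := Submodule.finrank_quotient_add_finrank X
  rw [qNumber, ← Projectivization.card_of_finrank K (V ⧸ X) (n := finrank K V - finrank K X)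
    (by omega), Nat.card_congr (Projectivization.equivSubmodule K (V ⧸ X))]
  symm
  refine Nat.card_congr (Equiv.ofBijective (fun H => ⟨H.1.comap X.mkQ, ?_, ?_⟩) ⟨?_, ?_⟩)
  · exact Submodule.le_comap_mkQ X H.1
  · have := finrank_map_mkQ_add_finrank (Submodule.le_comap_mkQ X H.1)
    rw [Submodule.map_comap_eq_of_surjective X.mkQ_surjective, H.2] at this
    omega
  · intro H H' h
    exact Subtype.ext (Submodule.comap_injective_of_surjective X.mkQ_surjective
      (congrArg Subtype.val h))
  · rintro ⟨Y, hXY, hY⟩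
    refine ⟨⟨Y.map X.mkQ, ?_⟩, Subtype.ext ?_⟩
    · have := finrank_map_mkQ_add_finrank hXY
      omega
    · simpa [Submodule.comap_map_mkQ] using hXY

/-- Taking annihilators identifies hyperplanes of `V` with lines of the dual. -/
theorem card_isHyperplaneOf_top [Finite K] :
    Nat.card {Y : Submodule K V // finrank K V = finrank K Y + 1} =
      qNumber (Nat.card K) (finrank K V) := by
  rw [qNumber, ← Projectivization.card_of_finrank K (Dual K V) Subspace.dual_finrank_eq,
    Nat.card_congr (Projectivization.equivSubmodule K (Dual K V))]
  refine Nat.card_congr (Equiv.subtypeEquiv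
    (Subspace.orderIsoFiniteDimensional.toEquiv.trans OrderDual.ofDual) fun Y => ?_)
  have := Subspace.finrank_add_finrank_dualAnnihilator_eq Y
  change _ ↔ finrank K (Submodule.dualAnnihilator Y) = 1
  omega

theorem card_isHyperplaneOf_left [Finite K] (X : Submodule K V) :
    Nat.card {Y // IsHyperplaneOf Y X} = qNumber (Nat.card K) (finrank K X) := by
  rw [← card_isHyperplaneOf_top (V := X)]
  symm
  refine Nat.card_congr (Equiv.ofBijective (fun H => ⟨H.1.map X.subtype, ?_, ?_⟩) ⟨?_, ?_⟩)
  · exact Submodule.map_subtype_le X H.1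
  · rw [Submodule.finrank_map_subtype_eq]
    exact H.2
  · intro H H' h
    exact Subtype.ext (Submodule.map_injective_of_injective X.injective_subtype
      (congrArg Subtype.val h))
  · rintro ⟨Y, hYX, hY⟩
    have e : (Y.comap X.subtype).map X.subtype = Y := by
      rw [Submodule.map_comap_subtype, inf_eq_right.2 hYX]
    refine ⟨⟨Y.comap X.subtype, ?_⟩, Subtype.ext e⟩
    rw [← Submodule.finrank_map_subtype_eq, e, hY]

theorem IsHyperplaneOf.inf_of_ne {X X' Y : Submodule K V} (h : IsHyperplaneOf X Y)
    (h' : IsHyperplaneOf X' Y) (hne : X ≠ X') :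
    Y = X ⊔ X' ∧ IsHyperplaneOf (X ⊓ X') X ∧ IsHyperplaneOf (X ⊓ X') X' := by
  have h1 := Submodule.finrank_sup_add_finrank_inf_eq X X'
  have h2 : finrank K X < finrank K ↥(X ⊔ X') := by
    refine Submodule.finrank_lt_finrank_of_lt (lt_of_le_of_ne le_sup_left fun h0 => hne ?_)
    have hle : X' ≤ X := by rw [h0]; exact le_sup_right
    exact (Submodule.eq_of_le_of_finrank_le hle (by have := h.2; have := h'.2; omega)).symm
  have h3 : X ⊔ X' = Y :=
    Submodule.eq_of_le_of_finrank_le (sup_le h.1 h'.1) (by rw [h.2]; omega)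
  rw [h3] at h1
  have h4 := h.2
  have h5 := h'.2
  exact ⟨h3.symm, ⟨inf_le_left, by omega⟩, ⟨inf_le_right, by omega⟩⟩

theorem IsHyperplaneOf.sup_of_ne {X X' Y : Submodule K V} (h : IsHyperplaneOf Y X)
    (h' : IsHyperplaneOf Y X') (hne : X ≠ X') :
    Y = X ⊓ X' ∧ IsHyperplaneOf X (X ⊔ X') ∧ IsHyperplaneOf X' (X ⊔ X') := by
  have h1 := Submodule.finrank_sup_add_finrank_inf_eq X X'
  have h2 : finrank K ↥(X ⊓ X') < finrank K X := by
    refine Submodule.finrank_lt_finrank_of_lt (lt_of_le_of_ne inf_le_left fun h0 => hne ?_)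
    have hle : X ≤ X' := by rw [← h0]; exact inf_le_right
    exact Submodule.eq_of_le_of_finrank_le hle (by have := h.2; have := h'.2; omega)
  have h3 : Y = X ⊓ X' :=
    Submodule.eq_of_le_of_finrank_le (le_inf h.1 h'.1) (by have := h.2; omega)
  rw [← h3] at h1
  have h4 := h.2
  have h5 := h'.2
  exact ⟨h3, ⟨le_sup_left, by omega⟩, ⟨le_sup_right, by omega⟩⟩

theorem gaussCoeff_zero : gaussCoeff K V 0 = 1 := by
  simp [gaussCoeff, Submodule.finrank_eq_zero]

theorem gaussCoeff_finrank : gaussCoeff K V (finrank K V) = 1 := by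
  have : ∀ X : Submodule K V, finrank K X = finrank K V ↔ X = ⊤ :=
    fun X => ⟨Submodule.eq_top_of_finrank_eq, fun h => by rw [h, finrank_top]⟩
  simp [gaussCoeff, this]

/-- Double counting of the pairs of a subspace of dimension `k + 1` and a hyperplane in it. -/
theorem gaussCoeff_succ_mul_qNumber [Finite K] (k : ℕ) :
    gaussCoeff K V (k + 1) * qNumber (Nat.card K) (k + 1) =
      gaussCoeff K V k * qNumber (Nat.card K) (finrank K V - k) := by
  classical
  have := finite_submodule (K := K) (V := V)
  have := Fintype.ofFinite (Submodule K V)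
  have key := Finset.card_mul_eq_card_mul (r := fun X Y : Submodule K V => IsHyperplaneOf Y X)
    (s := Finset.univ.filter fun X => finrank K X = k + 1)
    (t := Finset.univ.filter fun X => finrank K X = k)
    (m := qNumber (Nat.card K) (k + 1)) (n := qNumber (Nat.card K) (finrank K V - k)) ?_ ?_
  · simpa only [gaussCoeff, Nat.card_eq_fintype_card, Fintype.card_subtype] using key
  · intro X hX
    have hX' : finrank K X = k + 1 := by simpa using hX
    rw [← hX', ← card_isHyperplaneOf_left X, Nat.card_eq_fintype_card, Fintype.card_subtype,
      Finset.bipartiteAbove, Finset.filter_filter]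
    congr 1
    ext Y
    simp only [Finset.mem_filter, Finset.mem_univ, true_and, and_iff_right_iff_imp]
    intro h
    have := h.2
    omega
  · intro X hX
    have hX' : finrank K X = k := by simpa using hX
    rw [← hX', ← card_isHyperplaneOf_right X, Nat.card_eq_fintype_card, Fintype.card_subtype,
      Finset.bipartiteBelow, Finset.filter_filter]
    congr 1
    ext Y
    simp only [Finset.mem_filter, Finset.mem_univ, true_and, and_iff_right_iff_imp]
    intro h
    have := h.2
    omega

theorem gaussCoeff_reflect [Finite K] {k : ℕ} (hk : k ≤ finrank K V) :
    gaussCoeff K V (finrank K V - k) = gaussCoeff K V k := by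
  have hq : 0 < Nat.card K := Nat.card_pos
  induction k with
  | zero => rw [Nat.sub_zero, gaussCoeff_finrank, gaussCoeff_zero]
  | succ k ih =>
    have h1 := gaussCoeff_succ_mul_qNumber (K := K) (V := V) k
    have h2 := gaussCoeff_succ_mul_qNumber (K := K) (V := V) (finrank K V - (k + 1))
    have e1 : finrank K V - (k + 1) + 1 = finrank K V - k := by omega
    have e2 : finrank K V - (finrank K V - (k + 1)) = k + 1 := by omega
    rw [e1, e2, ih (by omega), ← h1] at h2
    have hpos : 0 < qNumber (Nat.card K) (k + 1) :=
      Finset.sum_pos (fun i _ => pow_pos hq i) ⟨0, by simp⟩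
    exact (Nat.eq_of_mul_eq_mul_right hpos h2).symm

theorem gaussCoeff_le_succ [Finite K] {k : ℕ} (hk : 2 * (k + 1) ≤ finrank K V) :
    gaussCoeff K V k ≤ gaussCoeff K V (k + 1) := by
  have hq : 0 < Nat.card K := Nat.card_pos
  have h1 := gaussCoeff_succ_mul_qNumber (K := K) (V := V) k
  have hpos : 0 < qNumber (Nat.card K) (k + 1) :=
      Finset.sum_pos (fun i _ => pow_pos hq i) ⟨0, by simp⟩
  have hle : qNumber (Nat.card K) (k + 1) ≤ qNumber (Nat.card K) (finrank K V - k) :=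
    Finset.sum_le_sum_of_subset (Finset.range_mono (by omega))
  refine Nat.le_of_mul_le_mul_right ?_ hpos
  rw [h1]
  exact Nat.mul_le_mul_left _ hle

end Subspaces

/-! ### Algebraic auxiliaries and Sylvester's identity -/

theorem Commute.polynomial_aeval_left {R A : Type*} [CommRing R] [Ring A] [Algebra R A] {a c : A}
    (h : Commute a c) (p : R[X]) : Commute (aeval a p) c := by
  induction p using Polynomial.induction_on' with
  | add p q hp hq => rw [map_add]; exact hp.add_left hq
  | monomial k x =>
    rw [aeval_monomial]
    exact Commute.mul_left (Algebra.commutes x c) (h.pow_left k)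

theorem Fintype.sum_subtype_eq_sum {P M : Type*} [Fintype P] [AddCommMonoid M] (p : P → Prop)
    [DecidablePred p] (f : P → M) (h : ∀ a, ¬ p a → f a = 0) : ∑ a : {a // p a}, f a = ∑ a, f a := by
  rw [← Finset.sum_subtype (Finset.univ.filter p) (by simp) f]
  exact Finset.sum_filter_of_ne fun a _ ha => by_contra fun hp => ha (h a hp)

/-- **Sylvester's determinant identity** with a scalar. -/
theorem Matrix.det_smul_one_add_mul_comm {F m k : Type*} [Field F] [Fintype m] [DecidableEq m]
    [Fintype k] [DecidableEq k] (A : Matrix m k F) (B : Matrix k m F) {c : F} (hc : c ≠ 0) :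
    (c • (1 : Matrix m m F) + A * B).det * c ^ Fintype.card k =
      c ^ Fintype.card m * (c • (1 : Matrix k k F) + B * A).det := by
  have h1 : c • (1 : Matrix m m F) + A * B = c • (1 + (c⁻¹ • A) * B) := by
    rw [smul_add, Matrix.smul_mul, smul_smul, mul_inv_cancel₀ hc, one_smul]
  have h2 : c • (1 : Matrix k k F) + B * A = c • (1 + B * (c⁻¹ • A)) := by
    rw [smul_add, Matrix.mul_smul, smul_smul, mul_inv_cancel₀ hc, one_smul]
  rw [h1, h2, Matrix.det_smul, Matrix.det_smul, Matrix.det_one_add_mul_comm]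
  ring

/-! ### Determinants for graded ladders -/

section Graded

open Matrix

variable {F P : Type*} [Field F] [Fintype P] [DecidableEq P] {r : P → ℕ}

/-- The determinant of a matrix which is block triangular for a grading with values at most `n`. -/
theorem Matrix.det_of_graded {n : ℕ} (hr : ∀ X, r X ≤ n) {N : Matrix P P F}
    (A : ℕ → Matrix P P F) (h0 : ∀ X Y, r Y < r X → N X Y = 0)
    (hA : ∀ X Y, r X = r Y → N X Y = A (r X) X Y) :
    N.det = ∏ j ∈ Finset.range (n + 1), ((A j).toSquareBlock r j).det := by
  have hbt : N.BlockTriangular r := fun X Y h => h0 X Y h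
  rw [hbt.det]
  have hsub : Finset.univ.image r ⊆ Finset.range (n + 1) := by
    intro j hj
    obtain ⟨X, -, rfl⟩ := Finset.mem_image.1 hj
    exact Finset.mem_range.2 (Nat.lt_succ_of_le (hr X))
  rw [← Finset.prod_subset hsub]
  · refine Finset.prod_congr rfl fun j _ => congrArg Matrix.det ?_
    ext ⟨X, hX⟩ ⟨Y, hY⟩
    have := hA X Y (hX.trans hY.symm)
    rw [hX] at this
    exact this
  · intro j _ hj
    have : IsEmpty {X // r X = j} :=
      ⟨fun X => hj (Finset.mem_image.2 ⟨X.1, Finset.mem_univ _, X.2⟩)⟩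
    exact Matrix.det_isEmpty

variable {U D T : Matrix P P F} {b : ℕ → F}

/-- A raising operator `U` and a lowering operator `D` for the grading `r` such that `U * D` and
`D * U` are, up to the scalar `b j` in degree `j`, given by a common operator `T`. -/
structure IsLadder (r : P → ℕ) (U D T : Matrix P P F) (b : ℕ → F) : Prop where
  raise : ∀ X Y, r X ≠ r Y + 1 → U X Y = 0
  lower : ∀ X Y, r Y ≠ r X + 1 → D X Y = 0
  mul_lower : U * D = diagonal (fun X => b (r X)) - T
  lower_mul : D * U = diagonal (fun X => b (r X + 1)) - T

namespace IsLadder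

theorem commute_raise (L : IsLadder r U D T b) : Commute T U := by
  have e1 : T = diagonal (fun X => b (r X)) - U * D := by rw [L.mul_lower]; abel
  have e2 : T = diagonal (fun X => b (r X + 1)) - D * U := by rw [L.lower_mul]; abel
  have e3 : diagonal (fun X => b (r X)) * U = U * diagonal (fun X => b (r X + 1)) := by
    ext X Y
    rw [diagonal_mul, mul_diagonal, mul_comm]
    by_cases h : r X = r Y + 1
    · rw [h]
    · rw [L.raise X Y h, zero_mul, zero_mul]
  change T * U = U * T
  calc T * U = (diagonal (fun X => b (r X)) - U * D) * U := by rw [← e1]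
    _ = U * (diagonal (fun X => b (r X + 1)) - D * U) := by
      rw [Matrix.sub_mul, Matrix.mul_sub, e3, Matrix.mul_assoc]
    _ = U * T := by rw [← e2]

theorem commute_lower (L : IsLadder r U D T b) : Commute T D := by
  have e1 : T = diagonal (fun X => b (r X)) - U * D := by rw [L.mul_lower]; abel
  have e2 : T = diagonal (fun X => b (r X + 1)) - D * U := by rw [L.lower_mul]; abel
  have e3 : diagonal (fun X => b (r X + 1)) * D = D * diagonal (fun X => b (r X)) := by
    ext X Y
    rw [diagonal_mul, mul_diagonal, mul_comm]
    by_cases h : r Y = r X + 1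
    · rw [h]
    · rw [L.lower X Y h, zero_mul, zero_mul]
  change T * D = D * T
  calc T * D = (diagonal (fun X => b (r X + 1)) - D * U) * D := by rw [← e2]
    _ = D * (diagonal (fun X => b (r X)) - U * D) := by
      rw [Matrix.sub_mul, Matrix.mul_sub, e3, Matrix.mul_assoc]
    _ = D * T := by rw [← e1]

theorem apply_eq_zero (L : IsLadder r U D T b) {X Y : P} (h : r X ≠ r Y) : T X Y = 0 := by
  have e1 : T = diagonal (fun X => b (r X)) - U * D := by rw [L.mul_lower]; abel
  have hne : X ≠ Y := fun h' => h (by rw [h'])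
  rw [e1, Matrix.sub_apply, diagonal_apply_ne _ hne, zero_sub, neg_eq_zero, Matrix.mul_apply]
  refine Finset.sum_eq_zero fun Z _ => ?_
  by_cases h1 : r X = r Z + 1
  · rw [L.lower Z Y (by omega), mul_zero]
  · rw [L.raise X Z h1, zero_mul]

/-- `T` preserves degree, hence commutes with the diagonal matrix of degrees, and so does every
polynomial in `T`. Characteristic zero keeps distinct degrees distinct in `F`. -/
theorem aeval_apply_eq_zero (L : IsLadder r U D T b) [CharZero F] (p : F[X]) {X Y : P} (h : r X ≠ r Y) :
    aeval T p X Y = 0 := by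
  have hc : Commute T (diagonal fun X => (r X : F)) := by
    change T * _ = _ * T
    ext X Y
    rw [diagonal_mul, mul_diagonal, mul_comm]
    by_cases h : r X = r Y
    · rw [h]
    · rw [L.apply_eq_zero h, mul_zero, mul_zero]
  have h1 := congrFun (congrFun (hc.polynomial_aeval_left p) X) Y
  rw [diagonal_mul, mul_diagonal, mul_comm] at h1
  by_contra h2
  exact h (Nat.cast_injective (mul_right_cancel₀ h2 h1).symm)

theorem mul_aeval_mul_apply (L : IsLadder r U D T b) (p : F[X]) (X Y : P) :
    (D * aeval T p * U) X Y = aeval T ((C (b (r X + 1)) - Polynomial.X) * p) X Y := by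
  rw [Matrix.mul_assoc, (L.commute_raise.polynomial_aeval_left p).eq, ← Matrix.mul_assoc,
    L.lower_mul, Matrix.sub_mul, Matrix.sub_apply, diagonal_mul, map_mul, map_sub, aeval_C, aeval_X,
    Matrix.sub_mul, Matrix.sub_apply, ← Algebra.smul_def, Matrix.smul_apply, smul_eq_mul]

/-- Sylvester's identity for two adjacent degrees. -/
theorem det_aeval_toSquareBlock_succ (L : IsLadder r U D T b) (p : F[X]) (j : ℕ) (hp : p.eval (b (j + 1)) ≠ 0) :
    ((aeval T p).toSquareBlock r (j + 1)).det * p.eval (b (j + 1)) ^ Fintype.card {X // r X = j} =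
      p.eval (b (j + 1)) ^ Fintype.card {X // r X = j + 1} *
        ((aeval T p).toSquareBlock r j).det := by
  -- Writing `p = c + (X - b (j+1)) h`, the operator `T - b (j+1)` is `-U * D` on degree `j + 1` and
  -- `-D * U` on degree `j`. The two blocks are therefore `c + A * B` and `c + B * A`.
  obtain ⟨h, hh⟩ := X_sub_C_dvd_sub_C_eval (p := p) (a := b (j + 1))
  set c := p.eval (b (j + 1)) with hc
  have hT : aeval T p = c • (1 : Matrix P P F) + (T - b (j + 1) • 1) * aeval T h := by
    rw [sub_eq_iff_eq_add'.1 hh, map_add, map_mul, map_sub, aeval_X, aeval_C, aeval_C,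
      Algebra.algebraMap_eq_smul_one, Algebra.algebraMap_eq_smul_one]
  let A : Matrix {X // r X = j + 1} {X // r X = j} F :=
    (U * aeval T h).submatrix Subtype.val Subtype.val
  let B : Matrix {X // r X = j} {X // r X = j + 1} F := (-D).submatrix Subtype.val Subtype.val
  have h1 : (aeval T p).toSquareBlock r (j + 1) = c • 1 + A * B := by
    ext ⟨X, hX⟩ ⟨Y, hY⟩
    have e : (A * B) ⟨X, hX⟩ ⟨Y, hY⟩ = (U * aeval T h * (-D)) X Y := by
      rw [Matrix.mul_apply, Matrix.mul_apply]
      refine Fintype.sum_subtype_eq_sum (fun Z => r Z = j)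
        (fun Z => (U * aeval T h) X Z * (-D) Z Y) fun Z hZ => ?_
      rw [Matrix.neg_apply, L.lower Z Y (by omega), neg_zero, mul_zero]
    rw [Matrix.add_apply, e, Matrix.mul_neg, Matrix.mul_assoc,
      (L.commute_lower.polynomial_aeval_left h).eq, ← Matrix.mul_assoc, L.mul_lower]
    change aeval T p X Y = _
    rw [hT]
    simp [Matrix.sub_mul, hX, Matrix.one_apply]
  have h2 : (aeval T p).toSquareBlock r j = c • 1 + B * A := by
    ext ⟨X, hX⟩ ⟨Y, hY⟩
    have e : (B * A) ⟨X, hX⟩ ⟨Y, hY⟩ = ((-D) * (U * aeval T h)) X Y := by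
      rw [Matrix.mul_apply, Matrix.mul_apply]
      refine Fintype.sum_subtype_eq_sum (fun Z => r Z = j + 1)
        (fun Z => (-D) X Z * (U * aeval T h) Z Y) fun Z hZ => ?_
      rw [Matrix.neg_apply, L.lower X Z (by omega), neg_zero, zero_mul]
    rw [Matrix.add_apply, e, Matrix.neg_mul, ← Matrix.mul_assoc, L.lower_mul]
    change aeval T p X Y = _
    rw [hT]
    simp [Matrix.sub_mul, hX, Matrix.one_apply]
  rw [h1, h2]
  exact Matrix.det_smul_one_add_mul_comm A B hp

/-- Nothing lies below degree 0, so `U * D` vanishes there and `T` is the scalar `b 0`. -/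
theorem det_aeval_toSquareBlock_zero (L : IsLadder r U D T b) (p : F[X]) :
    ((aeval T p).toSquareBlock r 0).det = p.eval (b 0) ^ Fintype.card {X // r X = 0} := by
  obtain ⟨h, hh⟩ := X_sub_C_dvd_sub_C_eval (p := p) (a := b 0)
  set c := p.eval (b 0) with hc
  have hT : aeval T p = c • (1 : Matrix P P F) + (T - b 0 • 1) * aeval T h := by
    rw [sub_eq_iff_eq_add'.1 hh, map_add, map_mul, map_sub, aeval_X, aeval_C, aeval_C,
      Algebra.algebraMap_eq_smul_one, Algebra.algebraMap_eq_smul_one]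
  have h1 : (aeval T p).toSquareBlock r 0 = c • 1 := by
    ext ⟨X, hX⟩ ⟨Y, hY⟩
    have hrow : ∀ Z, (T - b 0 • 1) X Z = 0 := by
      intro Z
      have e1 : T = diagonal (fun X => b (r X)) - U * D := by rw [L.mul_lower]; abel
      have e2 : (U * D) X Z = 0 := by
        rw [Matrix.mul_apply]
        exact Finset.sum_eq_zero fun Y _ => by rw [L.raise X Y (by omega), zero_mul]
      rw [e1, Matrix.sub_apply, Matrix.sub_apply, e2, Matrix.smul_apply, Matrix.one_apply,
        Matrix.diagonal_apply, hX]
      split_ifs <;> simp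
    change aeval T p X Y = _
    rw [hT, Matrix.add_apply, Matrix.mul_apply,
      Finset.sum_eq_zero fun Z _ => by rw [hrow Z, zero_mul]]
    simp [Matrix.one_apply]
  rw [h1, Matrix.det_smul, Matrix.det_one, mul_one]

theorem det_aeval_toSquareBlock_ne_zero (L : IsLadder r U D T b) (p : F[X]) (j : ℕ) (hp : ∀ i ≤ j, p.eval (b i) ≠ 0) :
    ((aeval T p).toSquareBlock r j).det ≠ 0 := by
  induction j with
  | zero =>
    rw [L.det_aeval_toSquareBlock_zero]
    exact pow_ne_zero _ (hp 0 le_rfl)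
  | succ j ih =>
    have h1 := L.det_aeval_toSquareBlock_succ p j (hp _ le_rfl)
    have h2 := mul_ne_zero (pow_ne_zero (Fintype.card {X // r X = j + 1}) (hp _ le_rfl))
      (ih fun i hi => hp i (by omega))
    rw [← h1] at h2
    exact left_ne_zero_of_mul h2

/-- The determinant of a tridiagonal combination of the operators `U` and `D`, whose degree-zero
part is replaced by the identity. -/
theorem det_tridiagonal (L : IsLadder r U D T b) [CharZero F] {n : ℕ} (hr : ∀ X, r X ≤ n) {d : ℕ → F} {Q : ℕ → F[X]}
    (hQ1 : Q (n + 1) = 1)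
    (hQ : ∀ j, j ≤ n → Q j = C (d j) * Q (j + 1) - (C (b (j + 1)) - Polynomial.X) * Q (j + 2))
    (hne : ∀ i j, i ≤ n → j ≤ n → (Q (j + 1)).eval (b i) ≠ 0) {M : Matrix P P F}
    (hM0 : ∀ X Y, r X = 0 → M X Y = (1 : Matrix P P F) X Y)
    (hM : ∀ X Y, r X ≠ 0 → M X Y = d (r X) * (1 : Matrix P P F) X Y - U X Y - D X Y) :
    M.det = (Q 1).eval (b 0) ^ Fintype.card {X // r X = 0} *
      ∏ j ∈ Finset.range n, (Q (j + 1)).eval (b (j + 1)) ^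
        ((Fintype.card {X // r X = j + 1} : ℤ) - Fintype.card {X // r X = j}) := by
  -- Blocks of the elimination: `E'` is `Q_{j+1}(T)` and `E` is `Q_j(T)` in degree `j`, except that
  -- `E` has `Q_1(T)` in degree 0, where the row of `M` is that of the identity. `D'` is `D` without
  -- its degree-0 rows for the same reason.
  let E' : Matrix P P F := of fun X Y => aeval T (Q (r X + 1)) X Y
  let E : Matrix P P F := of fun X Y => aeval T (Q (max (r X) 1)) X Y
  let D' : Matrix P P F := of fun X Y => if r X = 0 then 0 else D X Y
  have hE' : E'.det = ∏ j ∈ Finset.range (n + 1), ((aeval T (Q (j + 1))).toSquareBlock r j).det :=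
    Matrix.det_of_graded hr (fun j => aeval T (Q (j + 1)))
      (fun X Y h => L.aeval_apply_eq_zero _ h.ne') fun X Y _ => rfl
  have hD' : ∀ X Y, r Y ≠ r X + 1 → (D' * E') X Y = 0 := by
    intro X Y h
    rw [Matrix.mul_apply]
    refine Finset.sum_eq_zero fun Z _ => ?_
    by_cases hZ : r Z = r X + 1
    · have : E' Z Y = 0 := L.aeval_apply_eq_zero _ (by omega)
      rw [this, mul_zero]
    · have : D' X Z = 0 := by simp [D', L.lower X Z hZ]
      rw [this, zero_mul]
  have hED : (E - D' * E').det =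
      ∏ j ∈ Finset.range (n + 1), ((aeval T (Q (max j 1))).toSquareBlock r j).det := by
    refine Matrix.det_of_graded hr (fun j => aeval T (Q (max j 1))) (fun X Y h => ?_)
      fun X Y h => ?_
    · rw [Matrix.sub_apply, hD' X Y (by omega), sub_zero]
      exact L.aeval_apply_eq_zero _ h.ne'
    · rw [Matrix.sub_apply, hD' X Y (by omega), sub_zero]
      rfl
  have hU : (1 - U).det = 1 := by
    refine Matrix.det_eq_one_of_graded r (fun X => ?_) fun X Y hXY h => ?_
    · rw [Matrix.sub_apply, Matrix.one_apply_eq, L.raise X X (by omega), sub_zero]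
    · rw [Matrix.sub_apply, Matrix.one_apply_ne hXY, L.raise X Y (by omega), sub_zero]
  -- Block factorization: `E - D' * E'` is block upper triangular and `1 - U` is unitriangular. In
  -- degree `j > 0` it reduces to the recursion for `Q_j`, since `D * Q_{j+2}(T) * U = (b (j+1) - T)
  -- Q_{j+2}(T)`.
  have hmain : M * E' = (E - D' * E') * (1 - U) := by
    ext X Y
    have hEU : (E * U) X Y = (U * aeval T (Q (max (r X) 1))) X Y := by
      rw [← (L.commute_raise.polynomial_aeval_left _).eq, Matrix.mul_apply, Matrix.mul_apply]
      rfl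
    rw [Matrix.sub_mul, Matrix.mul_sub, Matrix.mul_sub, Matrix.mul_one, Matrix.mul_one,
      Matrix.sub_apply, Matrix.sub_apply, Matrix.sub_apply, hEU]
    by_cases hX : r X = 0
    · have h1 : (M * E') X Y = E' X Y := by
        rw [Matrix.mul_apply]
        simp_rw [hM0 X _ hX]
        rw [← Matrix.mul_apply, Matrix.one_mul]
      have h2 : ∀ N : Matrix P P F, (D' * N) X Y = 0 := by
        intro N
        rw [Matrix.mul_apply]
        exact Finset.sum_eq_zero fun Z _ => by simp [D', hX]
      have h3 : ∀ N : Matrix P P F, (U * N) X Y = 0 := by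
        intro N
        rw [Matrix.mul_apply]
        exact Finset.sum_eq_zero fun Z _ => by rw [L.raise X Z (by omega), zero_mul]
      rw [h1, h2, Matrix.mul_assoc, h2, h3]
      simp [E, E', hX]
    · have hmax : max (r X) 1 = r X := by omega
      have hD : ∀ N : Matrix P P F, (D' * N) X Y = (D * N) X Y := by
        intro N
        rw [Matrix.mul_apply, Matrix.mul_apply]
        exact Finset.sum_congr rfl fun Z _ => by simp [D', hX]
      have hDE : ∀ Z, (D * E') X Z = (D * aeval T (Q (r X + 2))) X Z := by
        intro Z
        rw [Matrix.mul_apply, Matrix.mul_apply]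
        refine Finset.sum_congr rfl fun Y _ => ?_
        by_cases h : r Y = r X + 1
        · simp [E', h]
        · rw [L.lower X Y h, zero_mul, zero_mul]
      have hUE : (U * E') X Y = (U * aeval T (Q (r X))) X Y := by
        rw [Matrix.mul_apply, Matrix.mul_apply]
        refine Finset.sum_congr rfl fun Z _ => ?_
        by_cases h : r X = r Z + 1
        · simp [E', h]
        · rw [L.raise X Z h, zero_mul, zero_mul]
      have hDEU : (D * (E' * U)) X Y = (D * aeval T (Q (r X + 2)) * U) X Y := by
        rw [← Matrix.mul_assoc, Matrix.mul_apply, Matrix.mul_apply]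
        simp_rw [hDE]
      have h1 : (M * E') X Y = d (r X) * E' X Y - (U * E') X Y - (D * E') X Y := by
        simp_rw [Matrix.mul_apply, hM X _ hX, sub_mul, Finset.sum_sub_distrib, mul_assoc,
          ← Finset.mul_sum]
        rw [← Matrix.mul_apply, Matrix.one_mul]
      have h2 : E X Y = d (r X) * E' X Y -
          aeval T ((C (b (r X + 1)) - Polynomial.X) * Q (r X + 2)) X Y := by
        change aeval T (Q (max (r X) 1)) X Y = _
        rw [hmax, hQ (r X) (hr X), map_sub, Matrix.sub_apply, map_mul (aeval T) (C _) _, aeval_C,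
          ← Algebra.smul_def, Matrix.smul_apply, smul_eq_mul]
        rfl
      rw [Matrix.mul_assoc, hD, hD, hDEU, L.mul_aeval_mul_apply, h1, h2, hmax, hUE]
      ring
  have hdet := congrArg Matrix.det hmain
  rw [Matrix.det_mul, Matrix.det_mul, hU, mul_one, hED, hE', Finset.prod_range_succ,
    Finset.prod_range_succ', hQ1, map_one] at hdet
  have hone : ((1 : Matrix P P F).toSquareBlock r n).det = 1 := by
    have : (1 : Matrix P P F).toSquareBlock r n = 1 := by
      ext ⟨X, hX⟩ ⟨Y, hY⟩
      change (1 : Matrix P P F) X Y = _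
      simp [Matrix.one_apply]
    rw [this, Matrix.det_one]
  -- Comparing `det E` and `det E'`, the polynomial `Q_{j+1}` occurs on degree `j + 1` in the former
  -- and on degree `j` in the latter, so Sylvester's identity applies.
  have hfac : ∀ j ∈ Finset.range n, ((aeval T (Q (max (j + 1) 1))).toSquareBlock r (j + 1)).det =
      (Q (j + 1)).eval (b (j + 1)) ^
        ((Fintype.card {X // r X = j + 1} : ℤ) - Fintype.card {X // r X = j}) *
        ((aeval T (Q (j + 1))).toSquareBlock r j).det := by
    intro j hj
    have hjn := Finset.mem_range.1 hj
    have hw := hne (j + 1) j hjn hjn.le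
    have h1 := L.det_aeval_toSquareBlock_succ (Q (j + 1)) j hw
    have hmax : max (j + 1) 1 = j + 1 := by omega
    rw [hmax, zpow_sub₀ hw, zpow_natCast, zpow_natCast, div_mul_eq_mul_div, eq_div_iff
      (pow_ne_zero _ hw)]
    exact h1
  rw [Finset.prod_congr rfl hfac, Finset.prod_mul_distrib, hone, mul_one] at hdet
  have hmax : max 0 1 = 1 := rfl
  rw [hmax, L.det_aeval_toSquareBlock_zero] at hdet
  have hnz : ∏ j ∈ Finset.range n, ((aeval T (Q (j + 1))).toSquareBlock r j).det ≠ 0 := by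
    refine Finset.prod_ne_zero_iff.2 fun j hj => L.det_aeval_toSquareBlock_ne_zero _ j fun i hi => ?_
    have hjn := Finset.mem_range.1 hj
    exact hne i j (by omega) hjn.le
  refine mul_right_cancel₀ hnz ?_
  rw [hdet]
  ring

end IsLadder

end Graded

/-! ### Determinants of tridiagonal matrices -/

section Tridiagonal

variable {R : Type*} [CommRing R]

/-- The `m × m` symmetric tridiagonal matrix with diagonal entries `a j, a (j + 1), …` and
off-diagonal entries `s j, s (j + 1), …`. -/
def tridiagonal (a s : ℕ → R) (j m : ℕ) : Matrix (Fin m) (Fin m) R :=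
  Matrix.of fun x y => if x.1 + 1 = y.1 then s (j + x) else if x.1 = y.1 then a (j + x) else
    if x.1 = y.1 + 1 then s (j + y) else 0

theorem tridiagonal_submatrix_succ (a s : ℕ → R) (j m : ℕ) :
    (tridiagonal a s j (m + 1)).submatrix Fin.succ Fin.succ = tridiagonal a s (j + 1) m := by
  ext x y
  simp only [tridiagonal, Matrix.submatrix_apply, Matrix.of_apply, Fin.val_succ,
    Nat.add_right_cancel_iff]
  rw [show j + (x.1 + 1) = j + 1 + x by ring, show j + (y.1 + 1) = j + 1 + y by ring]

/-- Expansion along the first row; the second minor has a single nonzero entry `s j` in its first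
column. -/
theorem det_tridiagonal_add_two (a s : ℕ → R) (j m : ℕ) :
    (tridiagonal a s j (m + 2)).det = a j * (tridiagonal a s (j + 1) (m + 1)).det -
      s j ^ 2 * (tridiagonal a s (j + 2) m).det := by
  have hrow : ∀ x : Fin m, tridiagonal a s j (m + 2) 0 x.succ.succ = 0 := by
    intro x
    simp [tridiagonal]
  have hcol : ∀ x : Fin m, tridiagonal a s j (m + 2) x.succ.succ 0 = 0 := by
    intro x
    simp [tridiagonal]
  have h00 : tridiagonal a s j (m + 2) 0 0 = a j := by simp [tridiagonal]
  have h01 : tridiagonal a s j (m + 2) 0 (Fin.succ 0) = s j := by simp [tridiagonal]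
  have h10 : tridiagonal a s j (m + 2) (Fin.succ 0) 0 = s j := by simp [tridiagonal]
  have hminor : ((tridiagonal a s j (m + 2)).submatrix Fin.succ
      (Fin.succAbove (Fin.succ 0))).det = s j * (tridiagonal a s (j + 2) m).det := by
    have hsub : ((tridiagonal a s j (m + 2)).submatrix Fin.succ
        (Fin.succAbove (Fin.succ 0))).submatrix Fin.succ Fin.succ =
          tridiagonal a s (j + 2) m := by
      rw [← tridiagonal_submatrix_succ a s (j + 1) m, ← tridiagonal_submatrix_succ a s j (m + 1)]
      rfl
    rw [Matrix.det_succ_column_zero, Fin.sum_univ_succ, Finset.sum_eq_zero fun x _ => ?_]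
    · simp only [Fin.succAbove_zero, hsub, Matrix.submatrix_apply]
      have : Fin.succAbove (Fin.succ (0 : Fin (m + 1))) 0 = 0 := rfl
      rw [this, h10]
      simp
    · have : Fin.succAbove (Fin.succ (0 : Fin (m + 1))) 0 = 0 := rfl
      rw [Matrix.submatrix_apply, this, hcol]
      simp
  rw [Matrix.det_succ_row_zero, Fin.sum_univ_succ, Fin.sum_univ_succ,
    Finset.sum_eq_zero fun x _ => by rw [hrow]; simp, h00, h01, hminor, Fin.succAbove_zero,
    tridiagonal_submatrix_succ]
  simp
  ring

end Tridiagonal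

/-! ### The polynomials `fPoly` as principal minors -/

section TailBlock

/-- The order isomorphism of `{0, …, n - k - j}` with the index set `{j, …, n - k}`. -/
def finEquivTailIndex {n k j : ℕ} (hkj : k ≤ j) : Fin (n - k + 1 - j) ≃ TailIndex n k j where
  toFun x := ⟨⟨j + x, Finset.mem_Icc.2 ⟨by omega, by omega⟩⟩, Nat.le_add_right _ _⟩
  invFun i := ⟨i.1.1 - j, by have := Finset.mem_Icc.1 i.1.2; have := i.2; omega⟩
  left_inv x := by ext; simp
  right_inv i := by
    have := i.2
    ext
    simp
    omega

theorem card_tailIndex {n k j : ℕ} (hkj : k ≤ j) :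
    Fintype.card (TailIndex n k j) = n - k + 1 - j := by
  rw [← Fintype.card_congr (finEquivTailIndex hkj), Fintype.card_fin]

theorem tailBlock_submatrix_finEquivTailIndex (q : ℕ) {n k j : ℕ} (hkj : k ≤ j) :
    (tailBlock q n k j).submatrix (finEquivTailIndex hkj) (finEquivTailIndex hkj) =
      tridiagonal (fun i => qNumber (q : ℝ) i + qNumber (q : ℝ) (n - i))
        (fun i => -√((q : ℝ) ^ k * qNumber (q : ℝ) (i + 1 - k) * qNumber (q : ℝ) (n - k - i)))
        j (n - k + 1 - j) := by
  ext x y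
  change blockMatrix q n k ⟨j + x, _⟩ ⟨j + y, _⟩ = _
  simp only [blockMatrix, tridiagonal, Matrix.of_apply, add_assoc, Nat.add_left_cancel_iff]
  by_cases h : x.1 + 1 = y.1
  · have e1 : j + y.1 - k = j + (x.1 + 1) - k := by omega
    have e2 : n - k - (j + y.1) + 1 = n - k - (j + x.1) := by omega
    rw [if_pos h, if_pos h, e1, e2]
  · rw [if_neg h, if_neg h]
    by_cases h' : x.1 = y.1
    · rw [if_pos h', if_pos h', h']
    · rw [if_neg h', if_neg h']

theorem aeval_fPoly_eq_det_tridiagonal (q : ℕ) {n k : ℕ} (hk : 2 * k ≤ n) :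
    ∀ m j, k ≤ j → n - k + 1 = j + m → aeval (q : ℝ) (fPoly n k j) =
      (tridiagonal (fun i => qNumber (q : ℝ) i + qNumber (q : ℝ) (n - i))
        (fun i => -√((q : ℝ) ^ k * qNumber (q : ℝ) (i + 1 - k) * qNumber (q : ℝ) (n - k - i)))
        j m).det := by
  intro m
  induction m using Nat.twoStepInduction with
  | zero =>
    intro j _ hj
    obtain rfl : j = n - k + 1 := hj.symm
    rw [aeval_fPoly_top _ hk, Matrix.det_isEmpty]
  | one =>
    intro j _ hj
    obtain rfl : j = n - k := by omega
    have e : n - (n - k) = k := by omega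
    rw [aeval_fPoly_base _ hk, Matrix.det_unique]
    simp [tridiagonal, e, add_comm]
  | more m ih0 ih1 =>
    intro j hkj hj
    have hq : (0 : ℝ) ≤ q := q.cast_nonneg
    rw [det_tridiagonal_add_two, aeval_fPoly_rec _ (by omega : j < n - k),
      ih1 (j + 1) (by omega) (by omega), ih0 (j + 2) (by omega) (by omega), neg_sq, Real.sq_sqrt]
    exact mul_nonneg (mul_nonneg (pow_nonneg hq _) (qNumber_nonneg hq _)) (qNumber_nonneg hq _)

theorem eval_fPoly_eq_det_tailBlock (q : ℕ) {n k j : ℕ} (hk : 2 * k ≤ n) (hkj : k ≤ j)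
    (hj : j ≤ n - k + 1) :
    (((fPoly n k j).eval (q : ℤ) : ℤ) : ℝ) = (tailBlock q n k j).det := by
  rw [← aeval_natCast_eq_cast_eval, aeval_fPoly_eq_det_tridiagonal q hk (n - k + 1 - j) j hkj
    (by omega), ← tailBlock_submatrix_finEquivTailIndex q hkj, Matrix.det_submatrix_equiv_self]

end TailBlock

/-! ### The ladder of subspaces and its Laplacian -/

section SubspaceLadder

open Module Matrix

variable {K V : Type*} [Field K] [AddCommGroup V] [Module K V] [Fintype (Submodule K V)]

variable (K V) in
open Classical in
/-- The raising operator: the `0`-`1` matrix of the relation `IsHyperplaneOf`. -/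
noncomputable def raiseMatrix : Matrix (Submodule K V) (Submodule K V) ℚ :=
  Matrix.of fun X Y => if IsHyperplaneOf Y X then 1 else 0

open Classical in
theorem raiseMatrix_mul_transpose_apply (X Y : Submodule K V) :
    (raiseMatrix K V * (raiseMatrix K V)ᵀ) X Y =
      (Finset.univ.filter fun Z => IsHyperplaneOf Z X ∧ IsHyperplaneOf Z Y).card := by
  simp [Matrix.mul_apply, raiseMatrix, ← ite_and, and_comm]

open Classical in
theorem transpose_mul_raiseMatrix_apply (X Y : Submodule K V) :
    ((raiseMatrix K V)ᵀ * raiseMatrix K V) X Y =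
      (Finset.univ.filter fun Z => IsHyperplaneOf X Z ∧ IsHyperplaneOf Y Z).card := by
  simp [Matrix.mul_apply, raiseMatrix, ← ite_and, and_comm]

variable [FiniteDimensional K V] [Finite K]

theorem card_lower_cast (X : Submodule K V) [DecidablePred fun Y => IsHyperplaneOf Y X] :
    ((Finset.univ.filter fun Y => IsHyperplaneOf Y X).card : ℚ) =
      qNumber (Nat.card K : ℚ) (finrank K X) := by
  rw [← Fintype.card_subtype, ← Nat.card_eq_fintype_card, card_isHyperplaneOf_left]
  simp [qNumber]

theorem card_upper_cast (X : Submodule K V) [DecidablePred fun Y => IsHyperplaneOf X Y] :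
    ((Finset.univ.filter fun Y => IsHyperplaneOf X Y).card : ℚ) =
      qNumber (Nat.card K : ℚ) (finrank K V - finrank K X) := by
  rw [← Fintype.card_subtype, ← Nat.card_eq_fintype_card, card_isHyperplaneOf_right]
  simp [qNumber]

variable [DecidableEq (Submodule K V)]

/-- Off the diagonal, the entries count common upper and common lower covers of `X ≠ Y`. Only `X ⊔
Y` and `X ⊓ Y` can occur, and each does exactly when the other does. -/
theorem transpose_mul_raiseMatrix :
    (raiseMatrix K V)ᵀ * raiseMatrix K V = raiseMatrix K V * (raiseMatrix K V)ᵀ +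
      diagonal fun X : Submodule K V => qNumber (Nat.card K : ℚ) (finrank K V - finrank K X) -
        qNumber (Nat.card K : ℚ) (finrank K X) := by
  classical
  ext X Y
  rw [Matrix.add_apply, raiseMatrix_mul_transpose_apply, transpose_mul_raiseMatrix_apply]
  by_cases hXY : X = Y
  · subst hXY
    simp only [and_self, diagonal_apply_eq, card_lower_cast, card_upper_cast]
    ring
  · rw [diagonal_apply_ne _ hXY, add_zero]
    congr 1
    have h1 : (Finset.univ.filter fun Z => IsHyperplaneOf X Z ∧ IsHyperplaneOf Y Z).card ≤ 1 :=
      Finset.card_le_one.2 fun Z hZ Z' hZ' => by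
        simp only [Finset.mem_filter, Finset.mem_univ, true_and] at hZ hZ'
        rw [(hZ.1.inf_of_ne hZ.2 hXY).1, (hZ'.1.inf_of_ne hZ'.2 hXY).1]
    have h2 : (Finset.univ.filter fun Z => IsHyperplaneOf Z X ∧ IsHyperplaneOf Z Y).card ≤ 1 :=
      Finset.card_le_one.2 fun Z hZ Z' hZ' => by
        simp only [Finset.mem_filter, Finset.mem_univ, true_and] at hZ hZ'
        rw [(hZ.1.sup_of_ne hZ.2 hXY).1, (hZ'.1.sup_of_ne hZ'.2 hXY).1]
    have h3 : 0 < (Finset.univ.filter fun Z => IsHyperplaneOf X Z ∧ IsHyperplaneOf Y Z).card ↔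
        0 < (Finset.univ.filter fun Z => IsHyperplaneOf Z X ∧ IsHyperplaneOf Z Y).card := by
      simp only [Finset.card_pos, Finset.Nonempty, Finset.mem_filter, Finset.mem_univ, true_and]
      exact ⟨fun ⟨_, h, h'⟩ => ⟨_, (h.inf_of_ne h' hXY).2⟩,
        fun ⟨_, h, h'⟩ => ⟨_, (h.sup_of_ne h' hXY).2⟩⟩
    omega

theorem isLadder_raiseMatrix :
    IsLadder (fun X : Submodule K V => finrank K X) (raiseMatrix K V) (raiseMatrix K V)ᵀ
      ((diagonal fun X : Submodule K V => qWeight (Nat.card K : ℚ) (finrank K V) (finrank K X)) -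
        raiseMatrix K V * (raiseMatrix K V)ᵀ)
      (qWeight (Nat.card K : ℚ) (finrank K V)) where
  raise X Y h := if_neg fun h' => h h'.2
  lower X Y h := if_neg fun h' => h h'.2
  mul_lower := by abel
  lower_mul := by
    rw [transpose_mul_raiseMatrix]
    have : (diagonal fun X : Submodule K V =>
        qWeight (Nat.card K : ℚ) (finrank K V) (finrank K X + 1)) =
        diagonal (fun X : Submodule K V => qWeight (Nat.card K : ℚ) (finrank K V) (finrank K X)) +
        diagonal fun X : Submodule K V => qNumber (Nat.card K : ℚ) (finrank K V - finrank K X) -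
        qNumber (Nat.card K : ℚ) (finrank K X) := by
      rw [diagonal_add]
      congr 1
      ext X
      rw [← qWeight_succ_sub_self _ (Submodule.finrank_le X)]
      ring
    rw [this]
    abel

theorem degree_subspaceGraph [DecidableRel (subspaceGraph K V).Adj] (X : Submodule K V) :
    ((subspaceGraph K V).degree X : ℚ) = qNumber (Nat.card K : ℚ) (finrank K X) +
      qNumber (Nat.card K : ℚ) (finrank K V - finrank K X) := by
  classical
  rw [← card_lower_cast, ← card_upper_cast, ← Nat.cast_add, ← Finset.card_union_of_disjoint,
    ← SimpleGraph.card_neighborFinset_eq_degree]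
  · congr 2
    ext Y
    simp [subspaceGraph_adj_iff, or_comm]
  · rw [Finset.disjoint_filter]
    intro Y _ h h'
    have := h.2
    have := h'.2
    omega

theorem complexity_subspaceGraph_eq_prod_zpow :
    (complexity (subspaceGraph K V) : ℚ) =
      (∏ i ∈ Finset.Icc 1 (finrank K V), qNumber (Nat.card K : ℚ) i) *
      ∏ j ∈ Finset.range (finrank K V), ((schurPoly (Nat.card K : ℚ) (finrank K V) (j + 1)).eval
        (qWeight (Nat.card K : ℚ) (finrank K V) (j + 1))) ^
          ((gaussCoeff K V (j + 1) : ℤ) - gaussCoeff K V j) := by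
  classical
  have hq : (0 : ℚ) ≤ Nat.card K := Nat.cast_nonneg _
  rw [complexity_eq_det_rootedLaplacian _ (⊥ : Submodule K V),
    isLadder_raiseMatrix.det_tridiagonal (n := finrank K V) (fun X => Submodule.finrank_le X)
      (d := fun j => qNumber (Nat.card K : ℚ) j + qNumber (Nat.card K : ℚ) (finrank K V - j))
      (Q := schurPoly (Nat.card K : ℚ) (finrank K V)) (schurPoly_succ_self _ _)
      (fun j hj => schurPoly_rec _ hj)
      (fun i j hi hj => (eval_schurPoly_pos hq (by omega) (by omega) (qWeight_nonneg hq _ _)).ne')]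
  · have hg : ∀ j, Fintype.card {X : Submodule K V // finrank K X = j} = gaussCoeff K V j :=
      fun j => Nat.card_eq_fintype_card.symm
    simp only [hg, gaussCoeff_zero, pow_one, qWeight_zero]
    rw [eval_zero_schurPoly _ (by omega)]
  · intro X Y hX
    have hX' : X = ⊥ := Submodule.finrank_eq_zero.1 hX
    simp [rootedLaplacian, hX', Matrix.one_apply, eq_comm]
  · intro X Y hX
    have hX' : X ≠ ⊥ := fun h => hX (Submodule.finrank_eq_zero.2 h)
    have hadj : (if (subspaceGraph K V).Adj X Y then (1 : ℚ) else 0) =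
        (if IsHyperplaneOf Y X then 1 else 0) + if IsHyperplaneOf X Y then 1 else 0 := by
      rw [subspaceGraph_adj_iff]
      by_cases h : IsHyperplaneOf X Y
      · have h' : ¬ IsHyperplaneOf Y X := fun h' => by
          have := h.2
          have := h'.2
          omega
        simp [h, h']
      · simp [h]
    simp only [rootedLaplacian, Matrix.of_apply, hX', if_false, hadj, degree_subspaceGraph,
      Matrix.one_apply, raiseMatrix, Matrix.transpose_apply]
    split_ifs <;> ring

end SubspaceLadder

/-! ### Pairing of the factors and the final formula -/

theorem Finset.prod_range_eq_prod_range_half {M : Type*} [CommMonoid M] {n : ℕ} (f : ℕ → M)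
    (hmid : n = 2 * (n / 2) + 1 → f (n / 2) = 1) :
    ∏ j ∈ Finset.range n, f j = ∏ j ∈ Finset.range (n / 2), f j * f (n - 1 - j) := by
  rw [Finset.prod_mul_distrib]
  generalize hm : n / 2 = m at *
  obtain h | h : n = m + m ∨ n = m + (m + 1) := by omega
  · conv_lhs => rw [h, Finset.prod_range_add, ← Finset.prod_range_reflect (fun x => f (m + x))]
    congr 1
    refine Finset.prod_congr rfl fun j hj => congrArg f ?_
    have := Finset.mem_range.1 hj
    omega
  · conv_lhs => rw [h, Finset.prod_range_add, Finset.prod_range_succ',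
      ← Finset.prod_range_reflect (fun x => f (m + (x + 1)))]
    rw [add_zero, hmid (by omega), mul_one]
    congr 1
    refine Finset.prod_congr rfl fun j hj => congrArg f ?_
    have := Finset.mem_range.1 hj
    omega

theorem complexity_subspaceGraph_eq {K V : Type*} [Field K] [Finite K] [AddCommGroup V]
    [Module K V] [FiniteDimensional K V] {n : ℕ} (hn : Module.finrank K V = n) :
    (complexity (subspaceGraph K V) : ℚ) =
      (∏ i ∈ Finset.Icc 1 n, qNumber (Nat.card K : ℚ) i) *
        ∏ k ∈ Finset.Icc 1 (n / 2),
          (aeval (Nat.card K : ℚ) (fPoly n k k)) ^ (gaussCoeff K V k - gaussCoeff K V (k - 1)) := by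
  classical
  have := finite_submodule (K := K) (V := V)
  have := Fintype.ofFinite (Submodule K V)
  have hq : (0 : ℚ) ≤ Nat.card K := Nat.cast_nonneg _
  have hreflect : ∀ k ≤ n, gaussCoeff K V (n - k) = gaussCoeff K V k := by
    intro k hk
    subst hn
    exact gaussCoeff_reflect hk
  rw [complexity_subspaceGraph_eq_prod_zpow, hn, Finset.prod_range_eq_prod_range_half]
  · congr 1

    rw [show Finset.Icc 1 (n / 2) = Finset.Ico (0 + 1) (n / 2 + 1) by ext; simp,
      ← Finset.prod_Ico_add' _ 0 (n / 2) 1, ← Finset.range_eq_Ico]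
    refine Finset.prod_congr rfl fun j hj => ?_
    have hj' := Finset.mem_range.1 hj
    -- With `k = j + 1`, the partner factor is `Q_{n+1-k}` at the same point `b k` with the opposite
    -- exponent, so it cancels the common factor in `eval_schurPoly_qWeight`.
    have e1 : n - 1 - j + 1 = n + 1 - (j + 1) := by omega
    have e2 : gaussCoeff K V (n + 1 - (j + 1)) = gaussCoeff K V j := by
      rw [Nat.add_sub_add_right, hreflect j (by omega)]
    have e3 : gaussCoeff K V (n - 1 - j) = gaussCoeff K V (j + 1) := by
      rw [← hreflect (j + 1) (by omega)]
      congr 1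
      omega
    have hle : gaussCoeff K V j ≤ gaussCoeff K V (j + 1) := gaussCoeff_le_succ (by omega)
    have hpos := (eval_schurPoly_pos (n := n) (j := n + 1 - (j + 1)) hq (by omega) (by omega)
      (qWeight_nonneg hq n (j + 1))).ne'
    rw [e1, e2, e3, qWeight_reflect _ (by omega),
      eval_schurPoly_qWeight _ (by omega : 2 * (j + 1) ≤ n) le_rfl (by omega),
      ← neg_sub (gaussCoeff K V (j + 1) : ℤ), zpow_neg, mul_zpow, mul_assoc,
      mul_inv_cancel₀ (zpow_ne_zero _ hpos), mul_one, Nat.add_sub_cancel, ← Nat.cast_sub hle,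
      zpow_natCast]
  -- For odd `n` the middle factor has exponent 0, the two central Gaussian coefficients being
  -- equal.
  · intro h
    have h1 := hreflect (n / 2) (by omega)
    have h2 : n - n / 2 = n / 2 + 1 := by omega
    rw [h2] at h1
    rw [h1, sub_self, zpow_zero]

theorem theorem2 {K V : Type*} [Field K] [Finite K] [AddCommGroup V] [Module K V]
    [FiniteDimensional K V] (q n : ℕ) (hq : Nat.card K = q) (hn : Module.finrank K V = n) :
    -- the exponents below are genuine (untruncated) differences
    (∀ k ∈ Finset.Icc 1 (n / 2), gaussCoeff K V (k - 1) ≤ gaussCoeff K V k) ∧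
    ((complexity (subspaceGraph K V) : ℤ) =
      (∏ i ∈ Finset.Icc 1 n, qNumber (q : ℤ) i) *
        ∏ k ∈ Finset.Icc 1 (n / 2),
          ((fPoly n k k).eval (q : ℤ)) ^ (gaussCoeff K V k - gaussCoeff K V (k - 1))) ∧
    (∀ k j : ℕ, 2 * k ≤ n → k ≤ j → j ≤ n - k + 1 →
      Fintype.card (TailIndex n k j) = n - k + 1 - j ∧
      (((fPoly n k j).eval (q : ℤ) : ℤ) : ℝ) = (tailBlock q n k j).det) := by
  refine ⟨fun k hk => ?_, ?_, fun k j hk hkj hj =>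
    ⟨card_tailIndex hkj, eval_fPoly_eq_det_tailBlock q hk hkj hj⟩⟩
  · obtain ⟨h1, h2⟩ := Finset.mem_Icc.1 hk
    obtain ⟨k, rfl⟩ := Nat.exists_eq_add_of_le' h1
    exact gaussCoeff_le_succ (by omega)
  · have h := complexity_subspaceGraph_eq hn
    have hnum : ∀ i, qNumber (q : ℚ) i = ((qNumber (q : ℤ) i : ℤ) : ℚ) := fun i => by
      simp [qNumber]
    rw [hq] at h
    simp only [hnum, aeval_natCast_eq_cast_eval] at h
    exact_mod_cast h
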